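/- Let $n\ge 2$. Let $T_n$ be the set of $n\times n$ permutation matrices $\pi$ with $\pi_{ij}=0$ for all $j\ge i+2$, and for $1\le r,s\le n$ let $P_n(r,s)$ be the convex hull of those $\pi\in T_n$ with $\pi_{rs}=0$. (For $2\le s\le r\le n-1$ it is a facet of $P_n=\operatorname{conv}T_n$.) The relative volume $V_n(r,s)$ of $P_n(r,s)$ is its $d$-dimensional volume, $d=\dim P_n(r,s)$, divided by the minimum volume of a $d$-dimensional simplex with vertices in the affine lattice spanned by the vertices of $P_n(r,s)$. Let $A$ be the skew-symmetric $(n-1)\times(n-1)$ matrix with $A_{ij}=V_n(i,j+1)$ for $1\le j<i\le n-1$ and $A_{ii}=0$, $A_{ji}=-A_{ij}$. Then in every $2\times 2$ submatrix of $A$ the two diagonal sums are equal: for all $1\le i<k\le n-1$ and $1\le j<l\le n-1$, $$A_{ij}+A_{kl}=A_{il}+A_{kj}.$$ -/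

import Mathlib

open MeasureTheory
open scoped Pointwise

noncomputable section

/-- The affine lattice spanned by a set `T` of points: all points `p + g` with `p ∈ T` and `g` an
integer combination of differences of points of `T`. -/
def affineLattice {E : Type*} [AddCommGroup E] (T : Set E) : Set E :=
  {x | ∃ p ∈ T, ∃ g ∈ AddSubgroup.closure (T - T), x = p + g}

section RelativeVolume

variable {E : Type*} [NormedAddCommGroup E] [InnerProductSpace ℝ E]
  [MeasurableSpace E] [BorelSpace E]

/-- The dimension of the convex hull of `T`, that is, of the affine span of `T`. -/
def hullDim (T : Set E) : ℕ := Module.finrank ℝ (vectorSpan ℝ T)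

/-- The minimum volume of a (nondegenerate) simplex of the same dimension as the convex hull of
`T`, all of whose vertices lie in the affine lattice spanned by `T`.
Volume is `d`-dimensional Euclidean volume, where `d = hullDim T`. -/
def minSimplexVolume (T : Set E) : ENNReal :=
  sInf {v | ∃ w : Fin (hullDim T + 1) → E, (∀ i, w i ∈ affineLattice T) ∧
    AffineIndependent ℝ w ∧ v = μHE[hullDim T] (convexHull ℝ (Set.range w))}

/-- The relative volume of the convex hull of `T`: its volume (in its own dimension), expressed in
units of the minimum volume of a simplex with vertices in the affine lattice spanned by `T`. -/
def relVolume (T : Set E) : ℝ :=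
  (μHE[hullDim T] (convexHull ℝ T) / minSimplexVolume T).toReal

end RelativeVolume

/-- The permutation matrix of `σ`, as a point of the Euclidean space of `n × n` arrays. -/
def permPoint {n : ℕ} (σ : Equiv.Perm (Fin n)) : EuclideanSpace ℝ (Fin n × Fin n) :=
  WithLp.toLp 2 fun p => σ.permMatrix ℝ p.1 p.2

/-- The set `T_n` of `n × n` permutation matrices whose `(i, j)` entry is zero whenever
`j ≥ i + 2`. -/
def hessenbergPerms (n : ℕ) : Set (EuclideanSpace ℝ (Fin n × Fin n)) :=
  {x | (∃ σ : Equiv.Perm (Fin n), x = permPoint σ) ∧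
    ∀ i j : Fin n, (i : ℕ) + 2 ≤ (j : ℕ) → x (i, j) = 0}

/-- Those elements of `T_n` whose `(r, s)` entry is zero; their convex hull is the face
`P_n(r, s)` of `P_n`. -/
def faceVertices {n : ℕ} (r s : Fin n) : Set (EuclideanSpace ℝ (Fin n × Fin n)) :=
  {x ∈ hessenbergPerms n | x (r, s) = 0}

/-- The relative volume of the face `P_n(r, s)`. -/
def faceRelVolume {n : ℕ} (r s : Fin n) : ℝ := relVolume (faceVertices r s)

/-- The triangle of relative facet volumes, with a diagonal of zeroes added above its main diagonal
and zeroes elsewhere. In one-based numbering the row `i` and column `j` (`1 ≤ j < i ≤ n - 1`) of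
this matrix hold the relative volume of `P_n(i, j + 1)`. -/
def facetTriangle (n : ℕ) : Matrix (Fin (n - 1)) (Fin (n - 1)) ℝ := fun i j =>
  if j < i then
    faceRelVolume (n := n) ⟨(i : ℕ), by omega⟩ ⟨(j : ℕ) + 1, by omega⟩
  else 0

/-- The completion of the triangle of relative facet volumes to a skew-symmetric matrix. -/
def facetMatrix (n : ℕ) : Matrix (Fin (n - 1)) (Fin (n - 1)) ℝ :=
  facetTriangle n - (facetTriangle n).transpose

end

/-!
The array `u = rectangle p q a b`, with `b = p + 1` and `a ≤ p < q`, has entries `1` at `(p, a)` and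
`(q, b)` and entries `-1` at `(q, a)` and on the superdiagonal at `(p, b)`. Points of `P_n` may be
moved in the direction `u`, and this cuts the face with a zero at `(q, a)` into two pieces. From a
point `x` of this face one moves by `-min (x (p, a)) (x (q, b)) • u` until one of the two positive
corners vanishes. So the piece `x (p, a) ≤ x (q, b)` corresponds to the face with a zero at
`(p, a)`, and the piece `x (q, b) ≤ x (p, a)` to the face with a zero at `(q, b)`.

On the first piece the move agrees with the linear reflection `x ↦ x - (x (p, a) - x (q, a)) • u`,
which matches the affine lattices of the two faces (`IsExchange.reflect_image_subset`,
`IsExchange.reflect_mem_faceVertices`), and likewise on the second. A linear map that matches the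
lattices multiplies volumes and the minimum simplex volume by the same factor
(`relVolume_eq_of_image_subset`), and the two pieces overlap in a set of volume zero. Hence the
relative volumes satisfy `V(p, a) + V(q, p + 1) = V(q, a)` (`faceRelVolume_add_eq`). In terms of the
matrix `A = facetMatrix n` this is
`A k j + A j i = A k i` for `i < j < k`, hence for all `i`, `j`, `k` by skew-symmetry
(`facetMatrix_add`), and the equality of diagonal sums follows.

Two consequences of Birkhoff's theorem replace an analysis of the individual polytopes: the faces
are cut out by line sums and zeros (`mem_convexHull_permPoint_iff`), and an array of natural numbers
with all line sums `2` is a sum of two permutation matrices (`exists_eq_permPoint_add_permPoint`).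
The latter shows that the image of a vertex lies in the affine lattice.
-/

/-! ### Relative volume under linear maps that match the lattices -/

section RelativeVolume

variable {E : Type*} [NormedAddCommGroup E] [InnerProductSpace ℝ E]

theorem subset_affineLattice {E : Type*} [AddCommGroup E] (T : Set E) : T ⊆ affineLattice T :=
  fun p hp => ⟨p, hp, 0, zero_mem _, (add_zero p).symm⟩

theorem sub_mem_closure_of_mem_affineLattice {E : Type*} [AddCommGroup E] {T : Set E} {x y : E}
    (hx : x ∈ affineLattice T) (hy : y ∈ affineLattice T) :
    x - y ∈ AddSubgroup.closure (T - T) := by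
  obtain ⟨p, hp, g, hg, rfl⟩ := hx
  obtain ⟨q, hq, h, hh, rfl⟩ := hy
  have h1 : p - q ∈ AddSubgroup.closure (T - T) :=
    AddSubgroup.subset_closure (Set.sub_mem_sub hp hq)
  rw [show p + g - (q + h) = (p - q) + (g - h) by abel]
  exact add_mem h1 (sub_mem hg hh)

theorem closure_sub_le_vectorSpan (T : Set E) {g : E} (hg : g ∈ AddSubgroup.closure (T - T)) :
    g ∈ vectorSpan ℝ T := by
  have : AddSubgroup.closure (T - T) ≤ (vectorSpan ℝ T).toAddSubgroup := by
    rw [AddSubgroup.closure_le]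
    rintro _ ⟨x, hx, y, hy, rfl⟩
    exact vsub_mem_vectorSpan ℝ hx hy
  exact this hg

theorem affineLattice_subset_affineSpan (T : Set E) :
    affineLattice T ⊆ (affineSpan ℝ T : Set E) := by
  rintro _ ⟨p, hp, g, hg, rfl⟩
  rw [add_comm]
  exact AffineSubspace.vadd_mem_of_mem_direction
    (by rw [direction_affineSpan]; exact closure_sub_le_vectorSpan T hg)
    (subset_affineSpan ℝ T hp)

theorem image_affineLattice_subset (L : E ≃ₗ[ℝ] E) {T T' : Set E}
    (h : L '' T ⊆ affineLattice T') : L '' affineLattice T ⊆ affineLattice T' := by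
  have hcl : ∀ g ∈ AddSubgroup.closure (T - T), L g ∈ AddSubgroup.closure (T' - T') := by
    intro g hg
    induction hg using AddSubgroup.closure_induction with
    | mem x hx =>
      obtain ⟨a, ha, b, hb, rfl⟩ := hx
      simp only [map_sub]
      exact sub_mem_closure_of_mem_affineLattice (h ⟨a, ha, rfl⟩) (h ⟨b, hb, rfl⟩)
    | zero => simp
    | add x y _ _ hx hy => rw [map_add]; exact add_mem hx hy
    | neg x _ hx => rw [map_neg]; exact neg_mem hx
  rintro _ ⟨_, ⟨p, hp, g, hg, rfl⟩, rfl⟩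
  obtain ⟨p', hp', g', hg', hpp⟩ := h ⟨p, hp, rfl⟩
  exact ⟨p', hp', g' + L g, add_mem hg' (hcl g hg), by rw [map_add, hpp, add_assoc]⟩

theorem map_vectorSpan_le (L : E ≃ₗ[ℝ] E) {T T' : Set E} (h : L '' T ⊆ affineLattice T') :
    (vectorSpan ℝ T).map (L : E →ₗ[ℝ] E) ≤ vectorSpan ℝ T' := by
  rw [vectorSpan_def, Submodule.map_span, Submodule.span_le]
  rintro _ ⟨_, ⟨x, hx, y, hy, rfl⟩, rfl⟩
  have := closure_sub_le_vectorSpan T'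
    (sub_mem_closure_of_mem_affineLattice (h ⟨x, hx, rfl⟩) (h ⟨y, hy, rfl⟩))
  simpa using this

theorem hullDim_eq_of_image_subset [FiniteDimensional ℝ E] (L : E ≃ₗ[ℝ] E) {T T' : Set E}
    (h : L '' T ⊆ affineLattice T') (h' : L.symm '' T' ⊆ affineLattice T) :
    hullDim T' = hullDim T := by
  have h1 := Submodule.finrank_mono (map_vectorSpan_le L h)
  have h2 := Submodule.finrank_mono (map_vectorSpan_le L.symm h')
  rw [LinearEquiv.finrank_map_eq] at h1 h2
  exact le_antisymm h2 h1

/-- A set in the affine span of `T`, translated into the direction space. -/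
theorem exists_eq_image_of_subset_affineSpan {T S : Set E} {p : E} (hp : p ∈ affineSpan ℝ T)
    (hS : S ⊆ affineSpan ℝ T) :
    ∃ A : Set (vectorSpan ℝ T), S = (fun v => p + v) '' ((vectorSpan ℝ T).subtype '' A) := by
  refine ⟨{v | p + (v : E) ∈ S}, ?_⟩
  ext x
  constructor
  · intro hx
    have : x - p ∈ vectorSpan ℝ T := by
      rw [← direction_affineSpan]
      exact AffineSubspace.vsub_mem_direction (hS hx) hp
    exact ⟨x - p, ⟨⟨x - p, this⟩, by simpa using hx, rfl⟩, by simp⟩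
  · rintro ⟨_, ⟨v, hv, rfl⟩, rfl⟩
    exact hv

variable [MeasurableSpace E] [BorelSpace E]

/-- A linear automorphism multiplies the volumes of all subsets of one affine subspace by the same
factor. -/
theorem exists_euclideanHausdorffMeasure_image_eq_mul [FiniteDimensional ℝ E] (L : E ≃ₗ[ℝ] E)
    (T : Set E) :
    ∃ c : ENNReal, c ≠ 0 ∧ c ≠ ⊤ ∧ ∀ S ⊆ (affineSpan ℝ T : Set E),
      μHE[hullDim T] (L '' S) = c * μHE[hullDim T] S := by
  let f : vectorSpan ℝ T →ₗ[ℝ] E := (L : E →ₗ[ℝ] E) ∘ₗ (vectorSpan ℝ T).subtype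
  have hf : f.ker = ⊥ := by
    rw [LinearMap.ker_eq_bot]
    exact L.injective.comp Subtype.val_injective
  have hpos : 0 < f.normDet := by
    refine lt_of_le_of_ne f.normDet_nonneg fun h0 => ?_
    exact (LinearMap.normDet_eq_zero_iff_ker_ne_bot.1 h0.symm) hf
  refine ⟨ENNReal.ofReal f.normDet, by simpa using hpos, ENNReal.ofReal_ne_top, fun S hS => ?_⟩
  rcases S.eq_empty_or_nonempty with rfl | ⟨p, hp⟩
  · simp
  obtain ⟨A, rfl⟩ := exists_eq_image_of_subset_affineSpan (hS hp) hS
  have h1 : L '' ((fun v => p + v) '' ((vectorSpan ℝ T).subtype '' A))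
      = (fun v => L p + v) '' (f '' A) := by
    simp only [Set.image_image, map_add]
    rfl
  rw [h1, (isometry_add_left p).euclideanHausdorffMeasure_image,
    (isometry_add_left (L p)).euclideanHausdorffMeasure_image]
  have h2 : μHE[hullDim T] ((vectorSpan ℝ T).subtype '' A) = μHE[hullDim T] A :=
    isometry_subtype_coe.euclideanHausdorffMeasure_image A
  rw [h2]
  exact f.euclideanHausdorffMeasure_image A

/-- If a linear automorphism matches the affine lattices of `T` and `T'`, the relative volume of
the convex hull of `T'` can be measured in the affine span of `T`, in the lattice units of `T`. -/
theorem relVolume_eq_of_image_subset [FiniteDimensional ℝ E] (L : E ≃ₗ[ℝ] E) {T T' : Set E}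
    (h : L '' T ⊆ affineLattice T') (h' : L.symm '' T' ⊆ affineLattice T) :
    relVolume T' =
      (μHE[hullDim T] (L.symm '' convexHull ℝ T') / minSimplexVolume T).toReal := by
  have hd := hullDim_eq_of_image_subset L h h'
  obtain ⟨c, hc0, hct, hc⟩ := exists_euclideanHausdorffMeasure_image_eq_mul L T
  have hLat : ∀ w ∈ affineLattice T, L w ∈ affineLattice T' :=
    fun w hw => image_affineLattice_subset L h ⟨w, hw, rfl⟩
  have hLat' : ∀ w ∈ affineLattice T', L.symm w ∈ affineLattice T :=
    fun w hw => image_affineLattice_subset L.symm h' ⟨w, hw, rfl⟩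
  have hspan : ∀ w : Set E, w ⊆ affineLattice T → convexHull ℝ w ⊆ (affineSpan ℝ T : Set E) :=
    fun w hw => convexHull_min (hw.trans (affineLattice_subset_affineSpan T))
      (affineSpan ℝ T).convex
  have hconv : μHE[hullDim T] (convexHull ℝ T')
      = c * μHE[hullDim T] (L.symm '' convexHull ℝ T') := by
    rw [← hc, Set.image_image]
    · simp
    · have : L.symm '' convexHull ℝ T' = convexHull ℝ (L.symm '' T') :=
        LinearMap.image_convexHull (L.symm : E →ₗ[ℝ] E) T'
      rw [this]
      exact hspan _ h'
  have hmin : minSimplexVolume T' = c * minSimplexVolume T := by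
    have himg : ∀ (k : ℕ) (w : Fin k → E), L '' convexHull ℝ (Set.range w)
        = convexHull ℝ (Set.range (L ∘ w)) := by
      intro k w
      rw [Set.range_comp]
      exact LinearMap.image_convexHull (L : E →ₗ[ℝ] E) _
    have hset : {v | ∃ w : Fin (hullDim T' + 1) → E, (∀ i, w i ∈ affineLattice T') ∧
        AffineIndependent ℝ w ∧ v = μHE[hullDim T'] (convexHull ℝ (Set.range w))} =
        (fun v => c * v) '' {v | ∃ w : Fin (hullDim T + 1) → E, (∀ i, w i ∈ affineLattice T) ∧
        AffineIndependent ℝ w ∧ v = μHE[hullDim T] (convexHull ℝ (Set.range w))} := by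
      rw [hd]
      ext v
      constructor
      · rintro ⟨w, hw, hi, rfl⟩
        refine ⟨_, ⟨L.symm ∘ w, fun i => hLat' _ (hw i),
          hi.map' L.symm.toLinearMap.toAffineMap L.symm.injective, rfl⟩, ?_⟩
        have hw' : Set.range (L.symm ∘ w) ⊆ affineLattice T := by
          rintro _ ⟨i, rfl⟩
          exact hLat' _ (hw i)
        simp only
        rw [← hc _ (hspan _ hw'), himg]
        congr 3
        ext i
        simp
      · rintro ⟨_, ⟨w, hw, hi, rfl⟩, rfl⟩
        refine ⟨L ∘ w, fun i => hLat _ (hw i), hi.map' L.toLinearMap.toAffineMap L.injective, ?_⟩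
        have hw' : Set.range w ⊆ affineLattice T := by
          rintro _ ⟨i, rfl⟩
          exact hw i
        simp only
        rw [← hc _ (hspan _ hw'), himg]
    rw [minSimplexVolume, minSimplexVolume, hset, sInf_image', ← ENNReal.mul_iInf_of_ne hc0 hct,
      ← sInf_eq_iInf']
  rw [relVolume, hmin, hd, hconv, ENNReal.mul_div_mul_left _ _ hc0 hct]

/-- Inside the affine span of `T`, the kernel of a linear functional `f` has volume zero as soon as
`f` does not vanish at some point of `T`. -/
theorem euclideanHausdorffMeasure_setOf_eq_zero [FiniteDimensional ℝ E] {T S : Set E}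
    (hS : S ⊆ (affineSpan ℝ T : Set E)) (f : E →ₗ[ℝ] ℝ) (hfS : ∀ x ∈ S, f x = 0)
    {q : E} (hq : q ∈ T) (hfq : f q ≠ 0) : μHE[hullDim T] S = 0 := by
  rcases S.eq_empty_or_nonempty with rfl | ⟨p, hp⟩
  · simp
  obtain ⟨A, rfl⟩ := exists_eq_image_of_subset_affineSpan (hS hp) hS
  rw [(isometry_add_left p).euclideanHausdorffMeasure_image]
  have h2 : μHE[hullDim T] ((vectorSpan ℝ T).subtype '' A) = μHE[hullDim T] A :=
    isometry_subtype_coe.euclideanHausdorffMeasure_image A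
  rw [h2]
  let K : Submodule ℝ (vectorSpan ℝ T) := (f ∘ₗ (vectorSpan ℝ T).subtype).ker
  have hA : A ⊆ K := by
    intro v hv
    have h1 := hfS _ ⟨_, ⟨v, hv, rfl⟩, rfl⟩
    have h3 := hfS p hp
    simpa [K, h3] using h1
  have hK : K ≠ ⊤ := by
    intro hK
    have hqp : q - p ∈ vectorSpan ℝ T := by
      rw [← direction_affineSpan]
      exact AffineSubspace.vsub_mem_direction (subset_affineSpan ℝ T hq) (hS hp)
    have : (⟨q - p, hqp⟩ : vectorSpan ℝ T) ∈ K := hK ▸ Submodule.mem_top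
    have h4 : f (q - p) = 0 := this
    rw [map_sub, hfS p hp, sub_zero] at h4
    exact hfq h4
  exact measure_mono_null hA (Measure.addHaar_submodule μHE[Module.finrank ℝ (vectorSpan ℝ T)] K hK)

theorem euclideanHausdorffMeasure_convexHull_lt_top [FiniteDimensional ℝ E] {T : Set E}
    (hT : T.Finite) : μHE[hullDim T] (convexHull ℝ T) < ⊤ := by
  rcases T.eq_empty_or_nonempty with rfl | ⟨p, hp⟩
  · simp
  obtain ⟨A, hA⟩ := exists_eq_image_of_subset_affineSpan (subset_affineSpan ℝ T hp)
    (convexHull_subset_affineSpan T)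
  have hiso : Isometry ((fun v => p + v) ∘ (vectorSpan ℝ T).subtype) :=
    (isometry_add_left p).comp isometry_subtype_coe
  rw [← Set.image_comp] at hA
  have hcomp : IsCompact A := by
    rw [hiso.isEmbedding.isCompact_iff, ← hA]
    exact hT.isCompact_convexHull ℝ
  rw [hA, hiso.euclideanHausdorffMeasure_image]
  exact hcomp.measure_lt_top (μ := μHE[Module.finrank ℝ (vectorSpan ℝ T)])

end RelativeVolume

/-! ### Permutation matrices as points -/

section PermPoints

variable {n : ℕ}

theorem permPoint_apply (σ : Equiv.Perm (Fin n)) (i j : Fin n) :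
    permPoint σ (i, j) = if σ i = j then 1 else 0 := by
  simp [permPoint, PEquiv.toMatrix_apply, Equiv.toPEquiv, eq_comm]

theorem permPoint_nonneg (σ : Equiv.Perm (Fin n)) (z : Fin n × Fin n) : 0 ≤ permPoint σ z := by
  obtain ⟨i, j⟩ := z
  rw [permPoint_apply]
  split_ifs <;> norm_num

theorem permPoint_eq_zero_iff {σ : Equiv.Perm (Fin n)} {z : Fin n × Fin n} :
    permPoint σ z = 0 ↔ σ z.1 ≠ z.2 := by
  obtain ⟨i, j⟩ := z
  simp [permPoint_apply]

theorem permPoint_eq_one {σ : Equiv.Perm (Fin n)} {z : Fin n × Fin n} (h : σ z.1 = z.2) :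
    permPoint σ z = 1 := by
  obtain ⟨i, j⟩ := z
  simpa [permPoint_apply] using h

/-- All row sums and all column sums of the array `x` are equal to `c`. -/
def HasLineSums (x : EuclideanSpace ℝ (Fin n × Fin n)) (c : ℝ) : Prop :=
  (∀ i, ∑ j, x (i, j) = c) ∧ ∀ j, ∑ i, x (i, j) = c

theorem HasLineSums.add {x y : EuclideanSpace ℝ (Fin n × Fin n)} {c d : ℝ}
    (hx : HasLineSums x c) (hy : HasLineSums y d) : HasLineSums (x + y) (c + d) := by
  constructor <;> intro i <;> simp [Finset.sum_add_distrib, hx.1, hx.2, hy.1, hy.2]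

theorem HasLineSums.sub {x y : EuclideanSpace ℝ (Fin n × Fin n)} {c d : ℝ}
    (hx : HasLineSums x c) (hy : HasLineSums y d) : HasLineSums (x - y) (c - d) := by
  constructor <;> intro i <;> simp [Finset.sum_sub_distrib, hx.1, hx.2, hy.1, hy.2]

theorem HasLineSums.smul {x : EuclideanSpace ℝ (Fin n × Fin n)} {c : ℝ}
    (hx : HasLineSums x c) (t : ℝ) : HasLineSums (t • x) (t * c) := by
  constructor <;> intro i <;> simp [← Finset.mul_sum, hx.1, hx.2]

theorem hasLineSums_permPoint (σ : Equiv.Perm (Fin n)) : HasLineSums (permPoint σ) 1 := by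
  constructor
  · intro i
    simp [permPoint_apply]
  · intro j
    simp [permPoint_apply, ← Equiv.eq_symm_apply]

theorem mem_doublyStochastic_of_hasLineSums {x : EuclideanSpace ℝ (Fin n × Fin n)}
    (h0 : ∀ z, 0 ≤ x z) (h1 : HasLineSums x 1) :
    (Matrix.of fun i j => x (i, j)) ∈ doublyStochastic ℝ (Fin n) :=
  mem_doublyStochastic_iff_sum.2 ⟨fun i j => h0 (i, j), h1.1, h1.2⟩

/-- Birkhoff's theorem with prescribed zeros: the doubly stochastic arrays that vanish on `Z` are
the convex combinations of the permutation matrices that vanish on `Z`. -/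
theorem mem_convexHull_permPoint_iff {Z : Set (Fin n × Fin n)}
    {x : EuclideanSpace ℝ (Fin n × Fin n)} :
    x ∈ convexHull ℝ {y | (∃ σ : Equiv.Perm (Fin n), y = permPoint σ) ∧ ∀ z ∈ Z, y z = 0} ↔
      (∀ z, 0 ≤ x z) ∧ HasLineSums x 1 ∧ ∀ z ∈ Z, x z = 0 := by
  constructor
  · intro hx
    have hconv : Convex ℝ {x : EuclideanSpace ℝ (Fin n × Fin n) |
        (∀ z, 0 ≤ x z) ∧ HasLineSums x 1 ∧ ∀ z ∈ Z, x z = 0} := by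
      rintro x ⟨hx0, hx1, hxZ⟩ y ⟨hy0, hy1, hyZ⟩ a b ha hb hab
      refine ⟨fun z => ?_, ?_, fun z hz => ?_⟩
      · have := hx0 z
        have := hy0 z
        simp only [PiLp.add_apply, PiLp.smul_apply, smul_eq_mul]
        positivity
      · have := (hx1.smul a).add (hy1.smul b)
        rwa [mul_one, mul_one, hab] at this
      · simp [hxZ z hz, hyZ z hz]
    refine convexHull_min ?_ hconv hx
    rintro _ ⟨⟨σ, rfl⟩, hZ⟩
    exact ⟨permPoint_nonneg σ, hasLineSums_permPoint σ, hZ⟩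
  · rintro ⟨h0, h1, hZ⟩
    obtain ⟨w, hw0, hw1, hw⟩ := exists_eq_sum_perm_of_mem_doublyStochastic
      (mem_doublyStochastic_of_hasLineSums h0 h1)
    have hxw : x = ∑ σ, w σ • permPoint σ := by
      ext ⟨i, j⟩
      have := congrFun (congrFun hw i) j
      simp only [Matrix.sum_apply, Matrix.smul_apply, Matrix.of_apply] at this
      rw [← this]
      simp [permPoint]
    rw [hxw]
    -- permutations of weight zero may leave the zero pattern, so they are removed first
    have hsupp : ∑ σ, w σ • permPoint σ
        = ∑ σ ∈ Finset.univ.filter (fun σ => w σ ≠ 0), w σ • permPoint σ := by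
      symm
      apply Finset.sum_filter_of_ne
      intro σ _ hσ h
      exact hσ (by rw [h, zero_smul])
    have hsuppw : ∑ σ ∈ Finset.univ.filter (fun σ => w σ ≠ 0), w σ = 1 := by
      rw [Finset.sum_filter_ne_zero]
      exact hw1
    rw [hsupp]
    refine (convex_convexHull ℝ _).sum_mem (fun σ _ => hw0 σ) hsuppw fun σ hσ => ?_
    refine subset_convexHull ℝ _ ⟨⟨σ, rfl⟩, fun z hz => ?_⟩
    have hz0 := hZ z hz
    rw [hxw] at hz0
    simp only [WithLp.ofLp_sum, Finset.sum_apply, PiLp.smul_apply, smul_eq_mul] at hz0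
    rw [Finset.sum_eq_zero_iff_of_nonneg
      (fun τ _ => mul_nonneg (hw0 τ) (permPoint_nonneg τ z))] at hz0
    exact (mul_eq_zero.1 (hz0 σ (Finset.mem_univ _))).resolve_left (Finset.mem_filter.1 hσ).2

/-- A permutation matrix can be split off from an array of natural numbers with constant positive
line sums. -/
theorem exists_sub_permPoint_nat {x : EuclideanSpace ℝ (Fin n × Fin n)} {c : ℝ} (hc : 0 < c)
    (hx : ∀ z, ∃ m : ℕ, x z = m) (hs : HasLineSums x c) :
    ∃ σ : Equiv.Perm (Fin n), ∀ z, ∃ m : ℕ, (x - permPoint σ) z = m := by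
  have hmem : (c⁻¹ • x) ∈ convexHull ℝ {y : EuclideanSpace ℝ (Fin n × Fin n) |
      (∃ σ : Equiv.Perm (Fin n), y = permPoint σ) ∧ ∀ z ∈ {z | x z = 0}, y z = 0} := by
    rw [mem_convexHull_permPoint_iff]
    refine ⟨fun z => ?_, ?_, fun z hz => ?_⟩
    · obtain ⟨m, hm⟩ := hx z
      simp only [PiLp.smul_apply, smul_eq_mul, hm]
      positivity
    · have := hs.smul c⁻¹
      rwa [inv_mul_cancel₀ hc.ne'] at this
    · have hz' : x z = 0 := hz
      simp [hz']
  obtain ⟨y, ⟨σ, rfl⟩, hσ⟩ := convexHull_nonempty_iff.1 ⟨_, hmem⟩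
  refine ⟨σ, fun z => ?_⟩
  obtain ⟨m, hm⟩ := hx z
  by_cases hz : σ z.1 = z.2
  · cases m with
    | zero =>
      have := hσ z (by simpa using hm)
      rw [permPoint_eq_zero_iff] at this
      exact absurd hz this
    | succ m => exact ⟨m, by simp [hm, permPoint_eq_one hz]⟩
  · exact ⟨m, by simp [hm, permPoint_eq_zero_iff.2 hz]⟩

/-- An array of natural numbers with all line sums `2` is a sum of two permutation matrices. -/
theorem exists_eq_permPoint_add_permPoint {x : EuclideanSpace ℝ (Fin n × Fin n)}
    (hx : ∀ z, ∃ m : ℕ, x z = m) (hs : HasLineSums x 2) :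
    ∃ σ τ : Equiv.Perm (Fin n), x = permPoint σ + permPoint τ := by
  obtain ⟨σ, hσ⟩ := exists_sub_permPoint_nat two_pos hx hs
  have hs1 : HasLineSums (x - permPoint σ) 1 := by
    have := hs.sub (hasLineSums_permPoint σ)
    norm_num at this
    exact this
  obtain ⟨τ, hτ⟩ := exists_sub_permPoint_nat one_pos hσ hs1
  have hs0 : HasLineSums (x - permPoint σ - permPoint τ) 0 := by
    have := hs1.sub (hasLineSums_permPoint τ)
    norm_num at this
    exact this
  refine ⟨σ, τ, ?_⟩
  have h0 : x - permPoint σ - permPoint τ = 0 := by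
    ext ⟨i, j⟩
    have hnn : ∀ j ∈ Finset.univ, 0 ≤ (x - permPoint σ - permPoint τ) (i, j) := by
      intro j _
      obtain ⟨m, hm⟩ := hτ (i, j)
      rw [hm]
      positivity
    exact (Finset.sum_eq_zero_iff_of_nonneg hnn).1 (hs0.1 i) j (Finset.mem_univ j)
  rw [sub_sub, sub_eq_zero] at h0
  exact h0

/-! ### Hessenberg permutations -/

/-- The permutations `σ` whose matrices vanish above the superdiagonal: `σ i ≤ i + 1`. -/
def IsHessenberg (σ : Equiv.Perm (Fin n)) : Prop := ∀ i, (σ i : ℕ) ≤ i + 1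

/-- The positions at which the points of `faceVertices z.1 z.2` are required to vanish. -/
def zeroPattern (z : Fin n × Fin n) : Set (Fin n × Fin n) :=
  {y | (y.1 : ℕ) + 2 ≤ y.2} ∪ {z}

theorem faceVertices_eq (z : Fin n × Fin n) :
    faceVertices z.1 z.2 =
      {y | (∃ σ : Equiv.Perm (Fin n), y = permPoint σ) ∧ ∀ w ∈ zeroPattern z, y w = 0} := by
  ext y
  constructor
  · rintro ⟨⟨hσ, h1⟩, h2⟩
    refine ⟨hσ, ?_⟩
    rintro w (hw | rfl)
    · exact h1 w.1 w.2 hw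
    · exact h2
  · rintro ⟨hσ, h⟩
    exact ⟨⟨hσ, fun i j hij => h (i, j) (Or.inl hij)⟩, h z (Or.inr rfl)⟩

theorem permPoint_mem_faceVertices_iff {σ : Equiv.Perm (Fin n)} {z : Fin n × Fin n} :
    permPoint σ ∈ faceVertices z.1 z.2 ↔ IsHessenberg σ ∧ σ z.1 ≠ z.2 := by
  rw [faceVertices_eq]
  constructor
  · rintro ⟨-, h⟩
    refine ⟨fun i => ?_, permPoint_eq_zero_iff.1 (h z (Or.inr rfl))⟩
    by_contra! hi
    exact permPoint_eq_zero_iff.1 (h (i, σ i) (Or.inl hi)) rfl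
  · rintro ⟨h1, h2⟩
    refine ⟨⟨σ, rfl⟩, ?_⟩
    rintro w (hw | rfl)
    · rw [permPoint_eq_zero_iff]
      intro h
      have := h1 w.1
      rw [h] at this
      have : (w.1 : ℕ) + 2 ≤ w.2 := hw
      omega
    · exact permPoint_eq_zero_iff.2 h2

theorem exists_of_mem_faceVertices {x : EuclideanSpace ℝ (Fin n × Fin n)} {z : Fin n × Fin n}
    (hx : x ∈ faceVertices z.1 z.2) :
    ∃ σ : Equiv.Perm (Fin n), x = permPoint σ ∧ IsHessenberg σ ∧ σ z.1 ≠ z.2 := by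
  obtain ⟨⟨⟨σ, rfl⟩, -⟩, -⟩ := id hx
  exact ⟨σ, rfl, permPoint_mem_faceVertices_iff.1 hx⟩

theorem finite_faceVertices (r s : Fin n) : (faceVertices r s).Finite :=
  (Set.finite_range (permPoint (n := n))).subset fun _ ⟨⟨⟨σ, hσ⟩, _⟩, _⟩ => ⟨σ, hσ.symm⟩

/-- A Hessenberg permutation that maps `q` to some `a ≤ p < q` maps `p` to `p + 1`: otherwise it
would permute `{0, …, p}`, and `a` would be attained twice. -/
theorem IsHessenberg.apply_eq_succ {σ : Equiv.Perm (Fin n)} (h : IsHessenberg σ) {p q : Fin n}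
    (hpq : p < q) (hq : σ q ≤ p) : (σ p : ℕ) = p + 1 := by
  by_contra hne
  have hmaps : ∀ i ∈ Finset.Iic p, σ i ∈ Finset.Iic p := by
    intro i hi
    rw [Finset.mem_Iic, Fin.le_def] at *
    have h1 := h i
    rcases eq_or_ne i p with rfl | hip
    · omega
    · have : (i : ℕ) ≠ p := fun h => hip (Fin.ext h)
      omega
  obtain ⟨i, hi, hiq⟩ := Finset.surj_on_of_inj_on_of_card_le (fun i _ => σ i) hmaps
    (fun _ _ _ _ h => σ.injective h) le_rfl (σ q) (Finset.mem_Iic.2 hq)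
  have := σ.injective hiq
  rw [← this, Finset.mem_Iic] at hi
  exact absurd hi (not_le.2 hpq)

theorem val_cycleIcc {i j : Fin n} (hij : i ≤ j) (x : Fin n) :
    (Fin.cycleIcc i j x : ℕ) =
      if x < i then (x : ℕ) else if x < j then (x : ℕ) + 1 else if x = j then (i : ℕ) else x := by
  have : NeZero n := ⟨by have := x.2; omega⟩
  split_ifs with h1 h2 h3
  · rw [Fin.cycleIcc_of_lt h1]
  · rw [Fin.cycleIcc_of_ge_of_lt (not_lt.1 h1) h2]
    have h4 : (x : ℕ) + 1 < n := by
      have := j.2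
      rw [Fin.lt_def] at h2
      omega
    rw [Fin.val_add, Fin.val_one', Nat.add_mod_mod, Nat.mod_eq_of_lt h4]
  · rw [h3, Fin.cycleIcc_of_last hij]
  · rw [Fin.cycleIcc_of_gt (lt_of_le_of_ne (not_lt.1 h2) (Ne.symm h3))]

/-- The witness is the product of the cycles `(a … p)` and `(b … q)`. -/
theorem exists_isHessenberg_apply_eq {a p b q : Fin n} (hap : a ≤ p) (hpb : p < b) (hbq : b ≤ q) :
    ∃ σ : Equiv.Perm (Fin n), IsHessenberg σ ∧ σ p = a ∧ σ q = b := by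
  refine ⟨Fin.cycleIcc a p * Fin.cycleIcc b q, fun i => ?_, ?_, ?_⟩
  · rw [Equiv.Perm.mul_apply, val_cycleIcc hap]
    simp only [Fin.lt_def, Fin.ext_iff, val_cycleIcc hbq]
    simp only [Fin.lt_def, Fin.le_def] at *
    split_ifs <;> omega
  · apply Fin.ext
    rw [Equiv.Perm.mul_apply, val_cycleIcc hap]
    simp only [Fin.lt_def, Fin.ext_iff, val_cycleIcc hbq]
    simp only [Fin.lt_def, Fin.le_def] at *
    split_ifs <;> omega
  · apply Fin.ext
    rw [Equiv.Perm.mul_apply, val_cycleIcc hap]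
    simp only [Fin.lt_def, Fin.ext_iff, val_cycleIcc hbq]
    simp only [Fin.lt_def, Fin.le_def] at *
    split_ifs <;> omega

end PermPoints

/-! ### Exchanging along a rectangle -/

section Exchange

variable {n : ℕ}

/-- The array with entries `1` at `(r, s)` and `(r', s')`, entries `-1` at `(r, s')` and `(r', s)`,
and zeroes elsewhere (for `r ≠ r'` and `s ≠ s'`). -/
noncomputable def rectangle (r r' s s' : Fin n) : EuclideanSpace ℝ (Fin n × Fin n) :=
  WithLp.toLp 2 fun z => ((if z.1 = r then 1 else 0) - (if z.1 = r' then 1 else 0)) *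
    ((if z.2 = s then 1 else 0) - (if z.2 = s' then 1 else 0))

theorem rectangle_apply (r r' s s' i j : Fin n) :
    rectangle r r' s s' (i, j) = ((if i = r then 1 else 0) - (if i = r' then 1 else 0)) *
      ((if j = s then 1 else 0) - (if j = s' then 1 else 0)) := rfl

theorem hasLineSums_rectangle (r r' s s' : Fin n) : HasLineSums (rectangle r r' s s') 0 := by
  constructor
  · intro i
    simp [rectangle_apply, ← Finset.mul_sum]
  · intro j
    simp [rectangle_apply, ← Finset.sum_mul]

/-- The combinatorial situation in which moving along `rectangle r r' s s'` turns points with a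
zero at `z` into points with a zero at `(r, s)`. The position `z` is one of the two negative
corners of the rectangle; a Hessenberg permutation through `z` passes through both negative
corners, and some Hessenberg permutation passes through `(r', s')` but not through `(r, s)`. -/
structure IsExchange (r r' s s' : Fin n) (z : Fin n × Fin n) : Prop where
  row_ne : r ≠ r'
  col_ne : s ≠ s'
  corner : z = (r, s') ∨ z = (r', s)
  le_one : (s : ℕ) ≤ r + 1
  le_two : (s' : ℕ) ≤ r' + 1
  le_three : (s' : ℕ) ≤ r + 1
  le_four : (s : ℕ) ≤ r' + 1
  forced : ∀ σ : Equiv.Perm (Fin n), IsHessenberg σ → σ z.1 = z.2 → σ r = s' ∧ σ r' = s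
  witness : ∃ π : Equiv.Perm (Fin n), IsHessenberg π ∧ π r ≠ s ∧ π r' = s'

/-- The functional `x ↦ x e - x z`. -/
noncomputable def coordDiff (e z : Fin n × Fin n) :
    Module.Dual ℝ (EuclideanSpace ℝ (Fin n × Fin n)) :=
  (EuclideanSpace.proj e : EuclideanSpace ℝ (Fin n × Fin n) →L[ℝ] ℝ).toLinearMap -
    (EuclideanSpace.proj z : EuclideanSpace ℝ (Fin n × Fin n) →L[ℝ] ℝ).toLinearMap

theorem coordDiff_apply (e z : Fin n × Fin n) (x : EuclideanSpace ℝ (Fin n × Fin n)) :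
    coordDiff e z x = x e - x z := rfl

namespace IsExchange

variable {r r' s s' : Fin n} {z : Fin n × Fin n} (h : IsExchange r r' s s' z)
include h

theorem rectangle_first : rectangle r r' s s' (r, s) = 1 := by
  simp [rectangle_apply, h.row_ne, h.col_ne]

theorem rectangle_second : rectangle r r' s s' (r', s') = 1 := by
  simp [rectangle_apply, h.row_ne.symm, h.col_ne.symm]

theorem rectangle_corner : rectangle r r' s s' z = -1 := by
  rcases h.corner with rfl | rfl
  · simp [rectangle_apply, h.row_ne, h.col_ne.symm]
  · simp [rectangle_apply, h.row_ne.symm, h.col_ne]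

theorem rectangle_le_zero {w : Fin n × Fin n} (h1 : w ≠ (r, s)) (h2 : w ≠ (r', s')) :
    rectangle r r' s s' w = 0 ∨ rectangle r r' s s' w = -1 := by
  obtain ⟨i, j⟩ := w
  have := h.row_ne
  have := h.col_ne
  simp only [rectangle_apply]
  simp only [ne_eq, Prod.mk.injEq] at h1 h2
  split_ifs <;> simp_all

theorem rectangle_eq_zero {w : Fin n × Fin n} (hw : (w.1 : ℕ) + 2 ≤ w.2) :
    rectangle r r' s s' w = 0 := by
  obtain ⟨i, j⟩ := w
  have h1 := h.le_one
  have h2 := h.le_two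
  have h3 := h.le_three
  have h4 := h.le_four
  simp only [rectangle_apply, Fin.ext_iff]
  simp only at hw
  split_ifs <;> first | omega | simp

theorem coordDiff_rectangle : coordDiff (r, s) z (rectangle r r' s s') = 2 := by
  rw [coordDiff_apply, h.rectangle_first, h.rectangle_corner]
  norm_num

/-- The reflection in the direction of the rectangle that interchanges the coordinates `(r, s)`
and `z`. -/
noncomputable def reflect :
    EuclideanSpace ℝ (Fin n × Fin n) ≃ₗ[ℝ] EuclideanSpace ℝ (Fin n × Fin n) :=
  Module.reflection h.coordDiff_rectangle

theorem reflect_apply (x : EuclideanSpace ℝ (Fin n × Fin n)) :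
    h.reflect x = x - (x (r, s) - x z) • rectangle r r' s s' :=
  Module.reflection_apply x h.coordDiff_rectangle

theorem reflect_reflect (x : EuclideanSpace ℝ (Fin n × Fin n)) : h.reflect (h.reflect x) = x :=
  Module.involutive_reflection h.coordDiff_rectangle x

theorem symm_reflect : h.reflect.symm = h.reflect :=
  Module.reflection_symm h.coordDiff_rectangle

theorem witness_mem : ∃ π : Equiv.Perm (Fin n), permPoint π ∈ faceVertices r s ∧
    permPoint π ∈ faceVertices z.1 z.2 ∧ π r' = s' := by
  obtain ⟨π, hπ, h1, h2⟩ := h.witness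
  refine ⟨π, permPoint_mem_faceVertices_iff (z := (r, s)) |>.2 ⟨hπ, h1⟩,
    permPoint_mem_faceVertices_iff.2 ⟨hπ, ?_⟩, h2⟩
  intro hz
  have := (h.forced π hπ hz).2
  exact h.col_ne (this.symm.trans h2)

/-- Subtracting the rectangle from a vertex through `(r, s)` may produce the entry `-1` at
`(r', s')`. Adding the witness repairs this, and the resulting array of natural numbers is a sum of
two vertices. -/
theorem sub_rectangle_mem_affineLattice {σ : Equiv.Perm (Fin n)} (hσ : IsHessenberg σ)
    (hrs : σ r = s) : permPoint σ - rectangle r r' s s' ∈ affineLattice (faceVertices r s) := by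
  obtain ⟨π, hπ, -, hπ'⟩ := h.witness_mem
  have hπ0 := (permPoint_mem_faceVertices_iff (z := (r, s))).1 hπ
  have hnat : ∀ w, ∃ m : ℕ, (permPoint σ + permPoint π - rectangle r r' s s') w = m := by
    intro w
    have hp : ∀ τ : Equiv.Perm (Fin n), ∃ m : ℕ, permPoint τ w = m := fun τ => by
      by_cases hτ : τ w.1 = w.2
      · exact ⟨1, by simp [permPoint_eq_one hτ]⟩
      · exact ⟨0, by simp [permPoint_eq_zero_iff.2 hτ]⟩
    obtain ⟨a, ha⟩ := hp σ
    obtain ⟨b, hb⟩ := hp π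
    simp only [PiLp.add_apply, PiLp.sub_apply]
    by_cases h1 : w = (r, s)
    · subst h1
      exact ⟨b, by rw [h.rectangle_first, permPoint_eq_one hrs, hb]; ring⟩
    by_cases h2 : w = (r', s')
    · subst h2
      exact ⟨a, by rw [h.rectangle_second, permPoint_eq_one (z := (r', s')) hπ', ha]; ring⟩
    rcases h.rectangle_le_zero h1 h2 with h3 | h3
    · exact ⟨a + b, by rw [h3, ha, hb]; push_cast; ring⟩
    · exact ⟨a + b + 1, by rw [h3, ha, hb]; push_cast; ring⟩
  have hsum : HasLineSums (permPoint σ + permPoint π - rectangle r r' s s') 2 := by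
    have := ((hasLineSums_permPoint σ).add (hasLineSums_permPoint π)).sub
      (hasLineSums_rectangle r r' s s')
    norm_num at this
    exact this
  obtain ⟨τ, ρ, hτρ⟩ := exists_eq_permPoint_add_permPoint hnat hsum
  have hzero : ∀ w ∈ zeroPattern (r, s), permPoint τ w = 0 ∧ permPoint ρ w = 0 := by
    intro w hw
    have h0 : (permPoint σ + permPoint π - rectangle r r' s s') w = 0 := by
      simp only [PiLp.add_apply, PiLp.sub_apply]
      rcases hw with hw | rfl
      · rw [h.rectangle_eq_zero hw, permPoint_eq_zero_iff.2, permPoint_eq_zero_iff.2]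
        · norm_num
        · intro h'
          have h1 := hπ0.1 w.1
          have h2 : (w.1 : ℕ) + 2 ≤ w.2 := hw
          rw [h'] at h1
          omega
        · intro h'
          have h1 := hσ w.1
          have h2 : (w.1 : ℕ) + 2 ≤ w.2 := hw
          rw [h'] at h1
          omega
      · rw [h.rectangle_first, permPoint_eq_one hrs, permPoint_eq_zero_iff.2 hπ0.2]
        norm_num
    rw [hτρ, PiLp.add_apply] at h0
    exact (add_eq_zero_iff_of_nonneg (permPoint_nonneg τ w) (permPoint_nonneg ρ w)).1 h0
  have hmem := faceVertices_eq (r, s)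
  simp only at hmem
  have hτ : permPoint τ ∈ faceVertices r s := by
    rw [hmem]
    exact ⟨⟨τ, rfl⟩, fun w hw => (hzero w hw).1⟩
  have hρ : permPoint ρ ∈ faceVertices r s := by
    rw [hmem]
    exact ⟨⟨ρ, rfl⟩, fun w hw => (hzero w hw).2⟩
  refine ⟨_, hτ, permPoint ρ - permPoint π,
    AddSubgroup.subset_closure (Set.sub_mem_sub hρ hπ), ?_⟩
  rw [← add_sub_assoc, ← hτρ]
  abel

theorem reflect_image_subset :
    h.reflect '' faceVertices z.1 z.2 ⊆ affineLattice (faceVertices r s) := by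
  rintro _ ⟨x, hx, rfl⟩
  obtain ⟨σ, rfl, hσ, hz⟩ := exists_of_mem_faceVertices hx
  rw [h.reflect_apply, permPoint_eq_zero_iff.2 hz]
  by_cases hrs : σ r = s
  · rw [permPoint_eq_one hrs, sub_zero, one_smul]
    exact h.sub_rectangle_mem_affineLattice hσ hrs
  · rw [permPoint_eq_zero_iff.2 hrs, sub_zero, zero_smul, sub_zero]
    exact subset_affineLattice _ ((permPoint_mem_faceVertices_iff (z := (r, s))).2 ⟨hσ, hrs⟩)

/-- A vertex with a zero at `(r, s)` is either fixed by the reflection, or its two ones at the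
negative corners of the rectangle are moved to the positive corners. -/
theorem reflect_mem_faceVertices {y : EuclideanSpace ℝ (Fin n × Fin n)}
    (hy : y ∈ faceVertices r s) : h.reflect y ∈ faceVertices z.1 z.2 := by
  obtain ⟨σ, rfl, hσ, hrs⟩ := exists_of_mem_faceVertices (z := (r, s)) hy
  rw [h.reflect_apply, permPoint_eq_zero_iff.2 hrs]
  by_cases hz : σ z.1 = z.2
  · obtain ⟨h1, h2⟩ := h.forced σ hσ hz
    have heq : permPoint σ + rectangle r r' s s' = permPoint (σ * Equiv.swap r r') := by
      ext ⟨i, j⟩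
      have hr := h.row_ne
      have hs := h.col_ne
      rw [PiLp.add_apply, permPoint_apply, permPoint_apply, rectangle_apply,
        Equiv.Perm.mul_apply]
      by_cases hir : i = r
      · subst hir
        simp only [h1, h2, Equiv.swap_apply_left, hr, eq_comm (a := j)]
        simp
      by_cases hir' : i = r'
      · subst hir'
        simp only [h1, h2, Equiv.swap_apply_right, hir, eq_comm (a := j)]
        simp
      · rw [Equiv.swap_apply_of_ne_of_ne hir hir']
        simp [hir, hir']
    rw [permPoint_eq_one hz, zero_sub, neg_smul, one_smul, sub_neg_eq_add, heq,
      permPoint_mem_faceVertices_iff]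
    constructor
    · intro i
      rw [Equiv.Perm.mul_apply]
      by_cases hir : i = r
      · rw [hir, Equiv.swap_apply_left, h2]
        exact h.le_one
      by_cases hir' : i = r'
      · rw [hir', Equiv.swap_apply_right, h1]
        exact h.le_two
      · rw [Equiv.swap_apply_of_ne_of_ne hir hir']
        exact hσ i
    · rw [← hz, Equiv.Perm.mul_apply]
      intro h'
      have := σ.injective h'
      rcases h.corner with rfl | rfl
      · rw [Equiv.swap_apply_left] at this
        exact h.row_ne this.symm
      · rw [Equiv.swap_apply_right] at this
        exact h.row_ne this
  · rw [permPoint_eq_zero_iff.2 hz, sub_zero, zero_smul, sub_zero]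
    exact permPoint_mem_faceVertices_iff.2 ⟨hσ, hz⟩

/-- The reflection carries the convex hull of one face onto the part of the other face on one side
of a hyperplane. -/
theorem reflect_image_convexHull :
    h.reflect '' convexHull ℝ (faceVertices r s) =
      {x ∈ convexHull ℝ (faceVertices z.1 z.2) | x (r, s) ≤ x (r', s')} := by
  apply Set.Subset.antisymm
  · have himg : h.reflect '' convexHull ℝ (faceVertices r s)
        = convexHull ℝ (h.reflect '' faceVertices r s) :=
      LinearMap.image_convexHull h.reflect.toLinearMap _
    rw [himg]
    have hhalf : {x : EuclideanSpace ℝ (Fin n × Fin n) | x (r, s) ≤ x (r', s')} =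
        {x | coordDiff (r, s) (r', s') x ≤ 0} := by
      ext x
      simp [coordDiff_apply]
    have hconv : Convex ℝ {x : EuclideanSpace ℝ (Fin n × Fin n) | x (r, s) ≤ x (r', s')} := by
      rw [hhalf]
      exact convex_halfSpace_le (coordDiff (r, s) (r', s')).isLinear 0
    refine convexHull_min ?_ ((convex_convexHull ℝ _).inter hconv)
    rintro _ ⟨y, hy, rfl⟩
    refine ⟨subset_convexHull ℝ _ (h.reflect_mem_faceVertices hy), ?_⟩
    obtain ⟨σ, rfl, -, hrs⟩ := exists_of_mem_faceVertices (z := (r, s)) hy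
    have h0 := permPoint_nonneg σ (r', s')
    simp only [h.reflect_apply, PiLp.sub_apply, PiLp.smul_apply,
      h.rectangle_first, h.rectangle_second, permPoint_eq_zero_iff.2 hrs]
    simpa using h0
  · rintro x ⟨hx, hle⟩
    refine ⟨h.reflect x, ?_, h.reflect_reflect x⟩
    rw [faceVertices_eq, mem_convexHull_permPoint_iff] at hx
    obtain ⟨h0, h1, hZ⟩ := hx
    have hxz : x z = 0 := hZ z (Or.inr rfl)
    have hmem := faceVertices_eq (r, s)
    simp only at hmem
    rw [hmem, mem_convexHull_permPoint_iff, h.reflect_apply, hxz, sub_zero]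
    refine ⟨fun w => ?_, ?_, ?_⟩
    · simp only [PiLp.sub_apply, PiLp.smul_apply, smul_eq_mul]
      have hw := h0 w
      have hrs := h0 (r, s)
      by_cases hw1 : w = (r, s)
      · rw [hw1, h.rectangle_first]
        simp
      by_cases hw2 : w = (r', s')
      · rw [hw2, h.rectangle_second]
        linarith
      rcases h.rectangle_le_zero hw1 hw2 with h3 | h3 <;> rw [h3] <;> linarith
    · have := h1.sub ((hasLineSums_rectangle r r' s s').smul (x (r, s)))
      rwa [mul_zero, sub_zero] at this
    · rintro w (hw | rfl)
      · simp [h.rectangle_eq_zero hw, hZ w (Or.inl hw)]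
      · simp [h.rectangle_first]

theorem faceRelVolume_eq : faceRelVolume r s =
    (μHE[hullDim (faceVertices z.1 z.2)]
      {x ∈ convexHull ℝ (faceVertices z.1 z.2) | x (r, s) ≤ x (r', s')} /
        minSimplexVolume (faceVertices z.1 z.2)).toReal := by
  have hsymm : h.reflect.symm '' faceVertices r s ⊆ affineLattice (faceVertices z.1 z.2) := by
    rw [h.symm_reflect]
    rintro _ ⟨y, hy, rfl⟩
    exact subset_affineLattice _ (h.reflect_mem_faceVertices hy)
  rw [faceRelVolume, relVolume_eq_of_image_subset h.reflect h.reflect_image_subset hsymm,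
    h.symm_reflect, h.reflect_image_convexHull]

/-- The hyperplane between the two pieces cuts the face in a set of volume zero. -/
theorem euclideanHausdorffMeasure_inter_eq_zero :
    μHE[hullDim (faceVertices z.1 z.2)]
      ({x ∈ convexHull ℝ (faceVertices z.1 z.2) | x (r, s) ≤ x (r', s')} ∩
        {x ∈ convexHull ℝ (faceVertices z.1 z.2) | x (r', s') ≤ x (r, s)}) = 0 := by
  obtain ⟨π, hπ, hπz, hπ'⟩ := h.witness_mem
  have hπ0 := (permPoint_mem_faceVertices_iff (z := (r, s))).1 hπ
  refine euclideanHausdorffMeasure_setOf_eq_zero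
    (fun x hx => convexHull_subset_affineSpan _ hx.1.1) (coordDiff (r, s) (r', s'))
    (fun x hx => ?_) hπz ?_
  · rw [coordDiff_apply, le_antisymm hx.1.2 hx.2.2, sub_self]
  · rw [coordDiff_apply, permPoint_eq_zero_iff.2 hπ0.2,
      permPoint_eq_one (z := (r', s')) hπ']
    norm_num

end IsExchange

/-- If both positive corners of a rectangle can be exchanged with `z`, the face with a zero at `z`
splits into two pieces that are lattice equivalent to the faces belonging to these corners. -/
theorem faceRelVolume_add {r r' s s' : Fin n} {z : Fin n × Fin n} (h : IsExchange r r' s s' z)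
    (h' : IsExchange r' r s' s z) :
    faceRelVolume r s + faceRelVolume r' s' = faceRelVolume z.1 z.2 := by
  rw [h.faceRelVolume_eq, h'.faceRelVolume_eq, faceRelVolume, relVolume]
  set T := faceVertices z.1 z.2
  set m := minSimplexVolume T
  set A := {x ∈ convexHull ℝ T | x (r, s) ≤ x (r', s')} with hA
  set B := {x ∈ convexHull ℝ T | x (r', s') ≤ x (r, s)} with hB
  have hfin : μHE[hullDim T] (convexHull ℝ T) < ⊤ :=
    euclideanHausdorffMeasure_convexHull_lt_top (finite_faceVertices _ _)
  have hcont : ∀ w : Fin n × Fin n, Continuous fun x : EuclideanSpace ℝ (Fin n × Fin n) => x w :=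
    fun w => (EuclideanSpace.proj w : EuclideanSpace ℝ (Fin n × Fin n) →L[ℝ] ℝ).continuous
  have hBm : MeasurableSet B :=
    ((finite_faceVertices z.1 z.2).isClosed_convexHull ℝ).measurableSet.inter
      (isClosed_le (hcont _) (hcont _)).measurableSet
  have hunion : A ∪ B = convexHull ℝ T := by
    ext x
    constructor
    · rintro (hx | hx)
      · exact hx.1
      · exact hx.1
    · intro hx
      rcases le_total (x (r, s)) (x (r', s')) with hle | hle
      · exact Or.inl ⟨hx, hle⟩
      · exact Or.inr ⟨hx, hle⟩
  have hadd : μHE[hullDim T] A + μHE[hullDim T] B = μHE[hullDim T] (convexHull ℝ T) := by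
    rw [← measure_union_add_inter A hBm, hunion,
      h.euclideanHausdorffMeasure_inter_eq_zero, add_zero]
  rw [← hadd, ENNReal.add_lt_top] at hfin
  rw [← hadd]
  rcases eq_or_ne m 0 with hm | hm
  · -- the unit `m` is in fact positive, but additivity does not depend on it: a division by zero
    -- in `ENNReal` gives `0` or `⊤`, and `toReal` maps both to `0`
    have hdiv : ∀ a : ENNReal, (a / m).toReal = 0 := by
      intro a
      simp [hm]
    simp only [hdiv, add_zero]
  · rw [ENNReal.add_div, ENNReal.toReal_add (ENNReal.div_lt_top hfin.1.ne hm).ne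
      (ENNReal.div_lt_top hfin.2.ne hm).ne]

/-- Additivity of the face volumes along a rectangle whose corner `(p, b)` lies on the
superdiagonal. The witnesses have cycles `(0 … p)`, `(b … q)` for the corner `(q, b)` and `(a … p)`,
`(b … n - 1)` for the corner `(p, a)`; this is where `0 < a` and `q + 1 < n` are needed. -/
theorem faceRelVolume_add_eq {p q a b : Fin n} (ha : 0 < (a : ℕ)) (hap : a ≤ p)
    (hb : (b : ℕ) = p + 1) (hbq : b ≤ q) (hq : (q : ℕ) + 1 < n) :
    faceRelVolume p a + faceRelVolume q b = faceRelVolume q a := by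
  rw [Fin.le_def] at hap hbq
  have hpb : p < b := Fin.lt_def.2 (by omega)
  have hpq : p < q := Fin.lt_def.2 (by omega)
  have hab : a ≠ b := fun h => by
    rw [h] at hap
    omega
  have hforced : ∀ σ : Equiv.Perm (Fin n), IsHessenberg σ → σ q = a → σ p = b ∧ σ q = a := by
    intro σ hσ hσq
    refine ⟨Fin.ext ?_, hσq⟩
    rw [hb]
    exact hσ.apply_eq_succ hpq (hσq ▸ Fin.le_def.2 hap)
  let o : Fin n := ⟨0, by omega⟩
  let t : Fin n := ⟨n - 1, by omega⟩
  have hlast : q < t := Fin.lt_def.2 (by simp only [t]; omega)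
  obtain ⟨π, hπ, hπp, hπq⟩ := exists_isHessenberg_apply_eq (a := o) (p := p)
    (Fin.le_def.2 (Nat.zero_le _)) hpb (Fin.le_def.2 hbq)
  obtain ⟨ρ, hρ, hρp, hρt⟩ := exists_isHessenberg_apply_eq (Fin.le_def.2 hap) hpb
    ((Fin.le_def.2 hbq).trans hlast.le)
  refine faceRelVolume_add (z := (q, a)) ?_ ?_
  · refine ⟨hpq.ne, hab, Or.inr rfl, by omega, by omega, by omega, by omega, hforced,
      π, hπ, ?_, hπq⟩
    rw [hπp]
    intro h
    rw [← h] at ha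
    exact lt_irrefl _ ha
  · refine ⟨hpq.ne', hab.symm, Or.inl rfl, by omega, by omega, by omega, by omega,
      fun σ hσ hq => (hforced σ hσ hq).symm, ρ, hρ, ?_, hρp⟩
    intro h
    exact hlast.ne (ρ.injective (h.trans hρt.symm))

end Exchange

/-! ### The skew-symmetric matrix of face volumes -/

theorem facetMatrix_swap (n : ℕ) (i j : Fin (n - 1)) : facetMatrix n j i = -facetMatrix n i j := by
  simp [facetMatrix]

theorem facetMatrix_of_lt {n : ℕ} {i j : Fin (n - 1)} (h : j < i) :
    facetMatrix n i j =
      faceRelVolume (n := n) ⟨(i : ℕ), by omega⟩ ⟨(j : ℕ) + 1, by omega⟩ := by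
  simp [facetMatrix, facetTriangle, h, h.not_gt]

theorem facetMatrix_add_of_lt {n : ℕ} {i j k : Fin (n - 1)} (hij : i < j) (hjk : j < k) :
    facetMatrix n k j + facetMatrix n j i = facetMatrix n k i := by
  rw [facetMatrix_of_lt hij, facetMatrix_of_lt hjk, facetMatrix_of_lt (hij.trans hjk), add_comm]
  rw [Fin.lt_def] at hij hjk
  apply faceRelVolume_add_eq
  · simp
  · rw [Fin.le_def]
    simp only
    omega
  · rfl
  · rw [Fin.le_def]
    simp only
    omega
  · simp only
    omega

/-- By skew-symmetry the additivity for decreasing indices extends to all triples: the matrix is a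
coboundary, `A k i = f k - f i` for some function `f`. -/
theorem facetMatrix_add {n : ℕ} (i j k : Fin (n - 1)) :
    facetMatrix n k j + facetMatrix n j i = facetMatrix n k i := by
  have hs := facetMatrix_swap n
  have h0 : ∀ i, facetMatrix n i i = 0 := fun i => by have := hs i i; linarith
  have key : ∀ i j k, i ≤ j → j ≤ k →
      facetMatrix n k j + facetMatrix n j i = facetMatrix n k i := by
    intro i j k hij hjk
    rcases hij.eq_or_lt with rfl | hij
    · rw [h0, add_zero]
    rcases hjk.eq_or_lt with rfl | hjk
    · rw [h0, zero_add]
    exact facetMatrix_add_of_lt hij hjk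
  have h1 := hs i j
  have h2 := hs j k
  have h3 := hs i k
  -- for every ordering of the indices the claim is a signed form of the sorted case
  rcases le_total i j with hij | hij <;> rcases le_total j k with hjk | hjk <;>
    rcases le_total i k with hik | hik <;>
    first
    | linarith [key _ _ _ hij hjk]
    | linarith [key _ _ _ hik hjk]
    | linarith [key _ _ _ hij hik]
    | linarith [key _ _ _ hjk hij]
    | linarith [key _ _ _ hjk hik]
    | linarith [key _ _ _ hik hij]

theorem mainTheorem3 (n : ℕ) (hn : 2 ≤ n) (i k j l : Fin (n - 1)) (hik : i < k) (hjl : j < l) :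
    facetMatrix n i j + facetMatrix n k l = facetMatrix n i l + facetMatrix n k j := by
  linarith [facetMatrix_add j i k, facetMatrix_add l i k]
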